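/- **Setting.** A single user downloads files in slotted time $t\in\{0,1,2,\dots\}$. The file state $F(t)\in\{0,1\}$ is $1$ if a file is being downloaded and $0$ if the system is idle; the initial state $F(0)$ is arbitrary. Let $\mathcal A$ be a finite action set containing an idle action $0$, let $\phi:\mathcal A\to[0,1]$ (success probability) and $p:\mathcal A\to[0,\infty)$ (power) satisfy $\phi(0)=0$ and $p(0)=0$, and let $\overline B>0$ (mean file size), $\lambda\in(0,1]$ and $\beta>0$ (power budget) be constants. A policy chooses, on the basis of the history up to slot $t$ and possibly of independent randomization, an action $\alpha(t)\in\mathcal A$, with $\alpha(t)=0$ whenever $F(t)=0$. Given the history up to and including $F(t)$ and $\alpha(t)$, the next state satisfies $$\Pr[F(t+1)=0]=\phi(\alpha(t))\ \text{ if } F(t)=1,\qquad \Pr[F(t+1)=1]=\lambda\ \text{ if } F(t)=0 .$$ The throughput is $\liminf_{T\to\infty}\frac1T\sum_{t=0}^{T-1}\overline B\,\phi(\alpha(t))$. Let $\mu^*$ be the optimal throughput, that is, the supremum of the (expected) throughput over all policies for which, with probability 1, $\limsup_{T\to\infty}\frac1T\sum_{t=0}^{T-1}p(\alpha(t))\le\beta$.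 **Algorithm.** Let $t_0<t_1<t_2<\cdots$ be the slots $t$ with $F(t)=1$, and let $T[k]=t_{k+1}-t_k$. Define the virtual queue by $Q[0]=0$ and $$Q[k+1]=\max\{Q[k]+p(\alpha(t_k))-\beta T[k],\,0\}.$$ The frame-based drift-plus-penalty ratio algorithm with parameter $V\ge 0$ chooses at each slot $t_k$ an action $\alpha(t_k)$ that maximizes $$\frac{V\overline B\,\phi(a)-Q[k]\,p(a)}{1+\phi(a)/\lambda}$$ over $a\in\mathcal A$, with ties broken arbitrarily (without knowledge of the future). **Theorem.** There is a constant $C_0$, depending only on the system $(\mathcal A,\phi,p,\overline B,\lambda,\beta)$ and not on $V$ or on how ties are broken, such that the following holds for the algorithm with any parameter $V\ge0$. On every sample path $$\limsup_{T\to\infty}\frac1T\sum_{t=0}^{T-1}p(\alpha(t))\le\beta ,$$ and, if $V>0$, then with probability 1 $$\liminf_{T\to\infty}\frac1T\sum_{t=0}^{T-1}\overline B\,\phi(\alpha(t))\ \ge\ \mu^*-\frac{C_0}{V}.$$ -/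

import Mathlib

open MeasureTheory ProbabilityTheory Filter

/-- The data of the single-user file downloading problem with action set `A`:
success probability `φ`, power `p`, idle action, mean file size `B`, parameter `lam` of the
geometric idle times, and power budget `β`. -/
structure DownloadSystem (A : Type*) where
  /-- the idle action, written `0` in the mathematics -/
  idle : A
  /-- probability that the file is completed on a slot -/
  φ : A → ℝ
  /-- power expenditure on a slot -/
  p : A → ℝ
  /-- mean file size in bits -/
  B : ℝ
  /-- parameter of the geometric idle times -/
  lam : ℝ
  /-- average power budget -/
  β : ℝ
  φ_nonneg : ∀ a, 0 ≤ φ a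
  φ_le_one : ∀ a, φ a ≤ 1
  φ_idle : φ idle = 0
  p_nonneg : ∀ a, 0 ≤ p a
  p_idle : p idle = 0
  B_pos : 0 < B
  lam_pos : 0 < lam
  lam_le_one : lam ≤ 1
  β_pos : 0 < β

namespace DownloadSystem

variable {A : Type*} (S : DownloadSystem A)

/-- `S.IsControlled P ℱ F α`: on the probability space `(Ω, P)` with history `ℱ`, the file state
process `F` (`true` is state 1, `false` is state 0) is the two-state chain controlled by the
non-anticipating (possibly randomized and history dependent) decisions `α`. The initial state is
arbitrary. The two remaining transition probabilities are the complements of the listed ones. -/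
structure IsControlled {Ω : Type*} [m : MeasurableSpace Ω] (P : Measure Ω)
    (ℱ : Filtration ℕ m) (F : ℕ → Ω → Bool) (α : ℕ → Ω → A) : Prop where
  state_adapted : ∀ t, MeasurableSet[ℱ t] {ω | F t ω = true}
  action_adapted : ∀ t a, MeasurableSet[ℱ t] {ω | α t ω = a}
  idle_of_inactive : ∀ t ω, F t ω = false → α t ω = S.idle
  trans_active : ∀ t, ∀ᵐ ω ∂P, F t ω = true →
    (P⟦{ω' | F (t + 1) ω' = false} | ℱ t⟧) ω = S.φ (α t ω)
  trans_inactive : ∀ t, ∀ᵐ ω ∂P, F t ω = false →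
    (P⟦{ω' | F (t + 1) ω' = true} | ℱ t⟧) ω = S.lam

/-- `liminf (1/T) ∑_{t<T} B φ(α(t))` along one path of decisions. (For finite `A` the averages are
bounded, so this is the genuine lower limit.) -/
noncomputable def throughput (a : ℕ → A) : ℝ :=
  liminf (fun T : ℕ => (1 / (T : ℝ)) * ∑ t ∈ Finset.range T, S.B * S.φ (a t)) atTop

/-- `limsup (1/T) ∑_{t<T} p(α(t))` along one path of decisions. -/
noncomputable def avgPower (a : ℕ → A) : ℝ :=
  limsup (fun T : ℕ => (1 / (T : ℝ)) * ∑ t ∈ Finset.range T, S.p (a t)) atTop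

/-- The optimal throughput `μ*`: the supremum of the (expected) throughput over all controlled
processes that satisfy the average power constraint with probability 1. -/
noncomputable def optThroughput : ℝ :=
  sSup {r : ℝ | ∃ (Ω : Type) (m : MeasurableSpace Ω) (P : Measure Ω) (ℱ : Filtration ℕ m)
    (F : ℕ → Ω → Bool) (α : ℕ → Ω → A),
    IsProbabilityMeasure P ∧ S.IsControlled P ℱ F α ∧
    (∀ᵐ ω ∂P, S.avgPower (fun t => α t ω) ≤ S.β) ∧
    r = ∫ ω, S.throughput (fun t => α t ω) ∂P}

/-- The start `t_k` of renewal frame `k`: the `k`-th slot (counted from `k = 0`) in state 1. -/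
noncomputable def frameStart (f : ℕ → Bool) (k : ℕ) : ℕ :=
  Nat.nth (fun t => f t = true) k

/-- The frame size `T[k] = t_{k+1} - t_k`. -/
noncomputable def frameSize (f : ℕ → Bool) (k : ℕ) : ℝ :=
  (frameStart f (k + 1) : ℝ) - (frameStart f k : ℝ)

/-- The virtual queue `Q[k]` along one path of states and decisions. -/
noncomputable def queue (f : ℕ → Bool) (a : ℕ → A) : ℕ → ℝ
  | 0 => 0
  | k + 1 => max (queue f a k + S.p (a (frameStart f k)) - S.β * frameSize f k) 0

/-- The drift-plus-penalty ratio of action `x` when the queue value is `q`. -/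
noncomputable def dppRatio (V q : ℝ) (x : A) : ℝ :=
  (V * S.B * S.φ x - q * S.p x) / (1 + S.φ x / S.lam)

/-- The frame-based drift-plus-penalty ratio algorithm along one path: at each slot `t` in state 1,
which is the start of frame `k`, where `k` is the number of earlier slots in state 1, the decision
maximizes the ratio for the queue value `Q[k]`. Ties are broken arbitrarily. -/
def FollowsDPP (V : ℝ) (f : ℕ → Bool) (a : ℕ → A) : Prop :=
  ∀ t, f t = true → ∀ x : A,
    S.dppRatio V (S.queue f a (Nat.count (fun s => f s = true) t)) x ≤
      S.dppRatio V (S.queue f a (Nat.count (fun s => f s = true) t)) (a t)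

end DownloadSystem

/-! The frame queue is the trace on state-1 slots of a queue `Z` updated in every slot
(`queue_count`), because idle slots only drain it. The algorithm is thus greedy for `Z`. Once `Z` is
large compared with `V`, any action using power has a negative ratio and loses to the idle action,
so `Z` is bounded on every path (`exists_slotQueue_le`), and the power bound follows.

For throughput, both sides are compared with a linear program (`IsFeasible`). Limit points of the
empirical action frequencies of any admissible policy are feasible
(`exists_isFeasible_throughput_le`), so the program bounds the optimum. The greedy ratio beats every
feasible mixture; a quadratic Lyapunov function, corrected for the draining still to come in an idle
period, turns this into a slotwise drift inequality (`FollowsDPP.lyapunov_drift`). Its noise is a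
bounded martingale difference, whose averages vanish almost surely. Summing and dividing by `V * T`
leaves a loss of a constant over `V`. -/

/-! ### Strong law for bounded martingale differences -/

/-- **Kronecker's lemma** for the weights `t + 1`. -/
theorem tendsto_average_of_tendsto_sum_div {x : ℕ → ℝ} {c : ℝ}
    (h : Tendsto (fun n : ℕ => ∑ t ∈ Finset.range n, x t / ((t : ℝ) + 1)) atTop (nhds c)) :
    Tendsto (fun n : ℕ => (1 / (n : ℝ)) * ∑ t ∈ Finset.range n, x t) atTop (nhds 0) := by
  set Y : ℕ → ℝ := fun n => ∑ t ∈ Finset.range n, x t / ((t : ℝ) + 1) with hY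
  -- Summation by parts: the average of `x` becomes `Y n` minus a Cesàro mean of `Y`, and both have
  -- limit `c`.
  have habel : ∀ n : ℕ, ∑ t ∈ Finset.range n, x t
      = n * Y n - ∑ t ∈ Finset.range n, Y t := by
    intro n
    induction n with
    | zero => simp
    | succ n ih =>
      have hs : Y (n + 1) = Y n + x n / ((n : ℝ) + 1) := by simp [hY, Finset.sum_range_succ]
      have hn : (n : ℝ) + 1 ≠ 0 := by positivity
      rw [Finset.sum_range_succ, Finset.sum_range_succ, ih, hs]
      push_cast
      field_simp
      ring
  have hlim : Tendsto (fun n : ℕ => Y n - (n⁻¹ : ℝ) * ∑ t ∈ Finset.range n, Y t) atTop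
      (nhds (c - c)) := h.sub h.cesaro
  rw [sub_self] at hlim
  refine hlim.congr' ?_
  filter_upwards [eventually_gt_atTop 0] with n hn
  have hn' : (n : ℝ) ≠ 0 := by positivity
  rw [habel]
  field_simp

theorem exists_abs_sum_div_le {Ω : Type*} {d : ℕ → Ω → ℝ} {K : ℝ} (hK : ∀ t ω, |d t ω| ≤ K)
    (n : ℕ) : ∃ M, ∀ ω, |∑ t ∈ Finset.range n, d t ω / ((t : ℝ) + 1)| ≤ M := by
  refine ⟨∑ t ∈ Finset.range n, K / ((t : ℝ) + 1), fun ω => ?_⟩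
  refine (Finset.abs_sum_le_sum_abs _ _).trans (Finset.sum_le_sum fun t _ => ?_)
  have ht : (0 : ℝ) < (t : ℝ) + 1 := by positivity
  rw [abs_div, abs_of_pos ht]
  gcongr
  exact hK t ω

section MartingaleDifferences

variable {Ω : Type*} [m : MeasurableSpace Ω] {P : Measure Ω} [IsProbabilityMeasure P]
  {ℱ : Filtration ℕ m} {d : ℕ → Ω → ℝ} {K : ℝ}

theorem integrable_of_abs_le {f : Ω → ℝ} (hf : Measurable f) (hK : ∀ ω, |f ω| ≤ K) :
    Integrable f P :=
  Integrable.of_bound hf.aestronglyMeasurable K (ae_of_all _ hK)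

theorem measurable_sum_div (hd : ∀ t, Measurable[ℱ (t + 1)] (d t)) (n : ℕ) :
    Measurable[ℱ n] (fun ω => ∑ t ∈ Finset.range n, d t ω / ((t : ℝ) + 1)) := by
  refine Finset.measurable_fun_sum _ fun t ht => ?_
  have : Measurable[ℱ n] (d t) :=
    (hd t).mono (ℱ.mono (Finset.mem_range.1 ht)) le_rfl
  exact this.div_const _

theorem integral_mul_eq_zero_of_condExp_eq_zero {Y D : Ω → ℝ} {n : ℕ} {M : ℝ}
    (hY : Measurable[ℱ n] Y) (hM : ∀ ω, |Y ω| ≤ M) (hD : Integrable D P)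
    (h0 : P[D | ℱ n] =ᵐ[P] 0) : ∫ ω, Y ω * D ω ∂P = 0 := by
  have h := condExp_stronglyMeasurable_mul_of_bound (ℱ.le n) hY.stronglyMeasurable hD M
    (ae_of_all P hM)
  have h' : P[Y * D | ℱ n] =ᵐ[P] 0 := by
    filter_upwards [h, h0] with ω h1 h2
    rw [h1, Pi.mul_apply, h2]
    simp
  calc ∫ ω, Y ω * D ω ∂P = ∫ ω, (P[Y * D | ℱ n]) ω ∂P := (integral_condExp (ℱ.le n)).symm
    _ = ∫ ω, (0 : Ω → ℝ) ω ∂P := integral_congr_ae h'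
    _ = 0 := by simp

/-- Martingale increments are orthogonal, so only the squares survive. The weights make the bound
summable, which gives boundedness in L². -/
theorem integral_sq_sum_div_le (hd : ∀ t, Measurable[ℱ (t + 1)] (d t))
    (hK : ∀ t ω, |d t ω| ≤ K) (h0 : ∀ t, P[d t | ℱ t] =ᵐ[P] 0) (n : ℕ) :
    ∫ ω, (∑ t ∈ Finset.range n, d t ω / ((t : ℝ) + 1)) ^ 2 ∂P
      ≤ ∑ t ∈ Finset.range n, K ^ 2 * (1 / ((t : ℝ) + 1) ^ 2) := by
  have hdm : ∀ t, Measurable (d t) := fun t => (hd t).mono (ℱ.le _) le_rfl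
  have hdi : ∀ t, Integrable (d t) P := fun t => integrable_of_abs_le (hdm t) (hK t)
  induction n with
  | zero => simp
  | succ n ih =>
    obtain ⟨M, hM⟩ := exists_abs_sum_div_le hK n
    have hYm := measurable_sum_div hd n
    have hYm' := hYm.mono (ℱ.le n) le_rfl
    set Y : Ω → ℝ := fun ω => ∑ t ∈ Finset.range n, d t ω / ((t : ℝ) + 1)
    have hcross := integral_mul_eq_zero_of_condExp_eq_zero hYm hM (hdi n) (h0 n)
    have hsplit : ∀ ω, (∑ t ∈ Finset.range (n + 1), d t ω / ((t : ℝ) + 1)) ^ 2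
        = Y ω ^ 2 + (2 / ((n : ℝ) + 1)) * (Y ω * d n ω) + d n ω ^ 2 * (1 / ((n : ℝ) + 1) ^ 2) := by
      intro ω
      rw [Finset.sum_range_succ]
      change (Y ω + _) ^ 2 = _
      field_simp
      ring
    have hi1 : Integrable (fun ω => Y ω ^ 2) P := by
      refine integrable_of_abs_le (K := M ^ 2) (hYm'.pow_const 2) fun ω => ?_
      rw [abs_pow]
      exact pow_le_pow_left₀ (abs_nonneg _) (hM ω) 2
    have hi2 : Integrable (fun ω => Y ω * d n ω) P := by
      refine integrable_of_abs_le (K := M * K) (hYm'.mul (hdm n)) fun ω => ?_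
      rw [abs_mul]
      exact mul_le_mul (hM ω) (hK n ω) (abs_nonneg _) ((abs_nonneg _).trans (hM ω))
    have hsq : ∀ ω, d n ω ^ 2 ≤ K ^ 2 := fun ω => by
      rw [← sq_abs]
      exact pow_le_pow_left₀ (abs_nonneg _) (hK n ω) 2
    have hi3 : Integrable (fun ω => d n ω ^ 2) P := by
      refine integrable_of_abs_le (K := K ^ 2) ((hdm n).pow_const 2) fun ω => ?_
      rw [abs_of_nonneg (sq_nonneg _)]
      exact hsq ω
    have hi12 : Integrable (fun ω => Y ω ^ 2 + (2 / ((n : ℝ) + 1)) * (Y ω * d n ω)) P :=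
      hi1.add (hi2.const_mul _)
    simp_rw [hsplit]
    rw [integral_add hi12 (hi3.mul_const _),
      integral_add hi1 (hi2.const_mul _), integral_const_mul, hcross, integral_mul_const,
      Finset.sum_range_succ, mul_zero, add_zero]
    gcongr
    calc ∫ ω, d n ω ^ 2 ∂P ≤ ∫ _, K ^ 2 ∂P := integral_mono hi3 (integrable_const _) hsq
      _ = K ^ 2 := by simp

/-- **Strong law of large numbers** for bounded martingale differences. -/
theorem ae_tendsto_average_of_condExp_eq_zero (hd : ∀ t, Measurable[ℱ (t + 1)] (d t))
    (hK : ∀ t ω, |d t ω| ≤ K) (h0 : ∀ t, P[d t | ℱ t] =ᵐ[P] 0) :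
    ∀ᵐ ω ∂P, Tendsto (fun n : ℕ => (1 / (n : ℝ)) * ∑ t ∈ Finset.range n, d t ω) atTop
      (nhds 0) := by
  have hdm : ∀ t, Measurable (d t) := fun t => (hd t).mono (ℱ.le _) le_rfl
  set Y : ℕ → Ω → ℝ := fun n ω => ∑ t ∈ Finset.range n, d t ω / ((t : ℝ) + 1) with hYdef
  have hYm : ∀ n, Measurable[ℱ n] (Y n) := measurable_sum_div hd
  have hYi : ∀ n, Integrable (Y n) P := fun n => by
    obtain ⟨M, hM⟩ := exists_abs_sum_div_le hK n
    exact integrable_of_abs_le ((hYm n).mono (ℱ.le n) le_rfl) hM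
  have hYi2 : ∀ n, Integrable (fun ω => Y n ω ^ 2) P := fun n => by
    obtain ⟨M, hM⟩ := exists_abs_sum_div_le hK n
    refine integrable_of_abs_le (K := M ^ 2)
      (((hYm n).mono (ℱ.le n) le_rfl).pow_const 2) fun ω => ?_
    rw [abs_pow]
    exact pow_le_pow_left₀ (abs_nonneg _) (hM ω) 2
  have hmart : Martingale Y ℱ P := by
    refine martingale_of_condExp_sub_eq_zero_nat (fun n => (hYm n).stronglyMeasurable) hYi
      fun n => ?_
    have hdiff : Y (n + 1) - Y n = (1 / ((n : ℝ) + 1)) • d n := by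
      ext ω
      simp only [hYdef, Pi.sub_apply, Finset.sum_range_succ, Pi.smul_apply, smul_eq_mul]
      ring
    rw [hdiff]
    filter_upwards [condExp_smul (μ := P) (1 / ((n : ℝ) + 1)) (d n) (ℱ n), h0 n] with ω h1 h2
    rw [h1, Pi.smul_apply, h2]
    simp
  have hsum : Summable (fun t : ℕ => K ^ 2 * (1 / ((t : ℝ) + 1) ^ 2)) := by
    have h := (summable_nat_add_iff 1).2 (Real.summable_one_div_nat_pow.2 one_lt_two)
    push_cast at h
    exact h.mul_left _
  set R : ℝ := 1 + ∑' t : ℕ, K ^ 2 * (1 / ((t : ℝ) + 1) ^ 2) with hR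
  -- Via `|y| ≤ 1 + y ^ 2` the L² bound yields the L¹ bound needed for martingale convergence.
  have hL1 : ∀ n, ∫ ω, ‖Y n ω‖ ∂P ≤ R := fun n => by
    calc ∫ ω, ‖Y n ω‖ ∂P ≤ ∫ ω, (1 + Y n ω ^ 2) ∂P := by
          refine integral_mono (hYi n).norm ((integrable_const _).add (hYi2 n)) fun ω => ?_
          simp only [Real.norm_eq_abs]
          nlinarith [sq_abs (Y n ω), sq_nonneg (|Y n ω| - 1), abs_nonneg (Y n ω)]
      _ = 1 + ∫ ω, Y n ω ^ 2 ∂P := by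
          rw [integral_add (integrable_const _) (hYi2 n)]
          simp
      _ ≤ R := by
          have h1 := integral_sq_sum_div_le hd hK h0 n
          have h2 := hsum.sum_le_tsum (Finset.range n) (fun t _ => by positivity)
          have h3 := h1.trans h2
          linarith
  have hbdd : ∀ n, eLpNorm (Y n) 1 P ≤ (Real.toNNReal R : ENNReal) := fun n => by
    rw [eLpNorm_one_eq_lintegral_enorm, ← ofReal_integral_norm_eq_lintegral_enorm (hYi n)]
    exact ENNReal.ofReal_le_ofReal (hL1 n)
  filter_upwards [hmart.submartingale.exists_ae_tendsto_of_bdd hbdd] with ω ⟨c, hc⟩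
  exact tendsto_average_of_tendsto_sum_div hc

end MartingaleDifferences

/-! ### The slotwise queue: agreement with the frame queue, boundedness, power constraint -/

namespace DownloadSystem

variable {A : Type*} (S : DownloadSystem A)

theorem abs_average_le {g : A → ℝ} {C : ℝ} (hg : ∀ x, |g x| ≤ C) (a : ℕ → A) (T : ℕ) :
    |(1 / (T : ℝ)) * ∑ t ∈ Finset.range T, g (a t)| ≤ C := by
  have hC : 0 ≤ C := (abs_nonneg _).trans (hg (a 0))
  rcases Nat.eq_zero_or_pos T with rfl | hT
  · simpa using hC
  have hT' : (0 : ℝ) < T := by positivity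
  have h : |∑ t ∈ Finset.range T, g (a t)| ≤ T * C := by
    refine (Finset.abs_sum_le_sum_abs _ _).trans ?_
    refine (Finset.sum_le_sum fun t _ => hg (a t)).trans ?_
    simp
  rw [abs_mul, abs_of_pos (one_div_pos.2 hT'), one_div_mul_eq_div, div_le_iff₀ hT']
  linarith

theorem isBoundedUnder_le_average {g : A → ℝ} {C : ℝ} (hg : ∀ x, |g x| ≤ C) (a : ℕ → A) :
    IsBoundedUnder (· ≤ ·) atTop
      (fun T : ℕ => (1 / (T : ℝ)) * ∑ t ∈ Finset.range T, g (a t)) :=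
  isBoundedUnder_of ⟨C, fun T => (abs_le.1 (abs_average_le hg a T)).2⟩

theorem isBoundedUnder_ge_average {g : A → ℝ} {C : ℝ} (hg : ∀ x, |g x| ≤ C) (a : ℕ → A) :
    IsBoundedUnder (· ≥ ·) atTop
      (fun T : ℕ => (1 / (T : ℝ)) * ∑ t ∈ Finset.range T, g (a t)) :=
  isBoundedUnder_of ⟨-C, fun T => (abs_le.1 (abs_average_le hg a T)).1⟩

theorem exists_abs_p_le [Finite A] : ∃ C, ∀ x, |S.p x| ≤ C := by
  obtain ⟨C, hC⟩ := (Set.finite_range fun x => |S.p x|).bddAbove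
  exact ⟨C, fun x => hC ⟨x, rfl⟩⟩

theorem abs_B_mul_φ_le (x : A) : |S.B * S.φ x| ≤ S.B := by
  rw [abs_of_nonneg (mul_nonneg S.B_pos.le (S.φ_nonneg x))]
  exact mul_le_of_le_one_right S.B_pos.le (S.φ_le_one x)

theorem throughput_nonneg (a : ℕ → A) : 0 ≤ S.throughput a := by
  refine le_liminf_of_le (isBoundedUnder_le_average S.abs_B_mul_φ_le a).isCoboundedUnder_ge
    (Eventually.of_forall fun T => ?_)
  have := Finset.sum_nonneg fun t (_ : t ∈ Finset.range T) =>
    mul_nonneg S.B_pos.le (S.φ_nonneg (a t))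
  positivity

/-- The virtual queue updated on every slot. -/
noncomputable def slotQueue (a : ℕ → A) : ℕ → ℝ
  | 0 => 0
  | t + 1 => max (slotQueue a t + S.p (a t) - S.β) 0

theorem slotQueue_nonneg (a : ℕ → A) (t : ℕ) : 0 ≤ S.slotQueue a t := by
  cases t with
  | zero => exact le_rfl
  | succ t => exact le_max_right _ _

theorem slotQueue_succ_ge (a : ℕ → A) (t : ℕ) :
    S.slotQueue a t + S.p (a t) - S.β ≤ S.slotQueue a (t + 1) :=
  le_max_left _ _

theorem sq_slotQueue_succ_le (a : ℕ → A) (t : ℕ) :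
    S.slotQueue a (t + 1) ^ 2 ≤ (S.slotQueue a t + S.p (a t) - S.β) ^ 2 := by
  change (max _ _) ^ 2 ≤ _
  rcases max_cases (S.slotQueue a t + S.p (a t) - S.β) 0 with ⟨h, _⟩ | ⟨h, _⟩
  · rw [h]
  · rw [h, zero_pow two_ne_zero]
    positivity

theorem sum_p_le (a : ℕ → A) (T : ℕ) :
    ∑ t ∈ Finset.range T, S.p (a t) ≤ S.β * T + S.slotQueue a T := by
  induction T with
  | zero => simp [slotQueue]
  | succ T ih =>
    have := S.slotQueue_succ_ge a T
    rw [Finset.sum_range_succ]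
    push_cast
    linarith

variable {S} {f : ℕ → Bool} {a : ℕ → A}

/-- Before the first active slot the queue stays at 0. Within a frame, draining by `β` slot by slot
with truncation at 0 equals a single truncated drain. Only frames already begun occur, so the
default value of `Nat.nth` never enters. -/
theorem queue_count (hidle : ∀ t, f t = false → a t = S.idle) (t : ℕ) :
    (Nat.count (fun s => f s = true) t = 0 → S.slotQueue a t = 0) ∧
    ∀ k, Nat.count (fun s => f s = true) t = k + 1 →
      S.slotQueue a t =
        max (S.queue f a k + S.p (a (frameStart f k)) - S.β * (t - frameStart f k)) 0 := by
  induction t with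
  | zero => simp [slotQueue]
  | succ t ih =>
    have hβ := S.β_pos
    cases hft : f t with
    | false =>
      have hc : Nat.count (fun s => f s = true) (t + 1) = Nat.count (fun s => f s = true) t := by
        simp [Nat.count_succ, hft]
      have hp : S.p (a t) = 0 := by rw [hidle t hft, S.p_idle]
      have hz : S.slotQueue a (t + 1) = max (S.slotQueue a t - S.β) 0 := by
        simp [slotQueue, hp]
      rw [hc, hz]
      refine ⟨fun h => ?_, fun k hk => ?_⟩
      · rw [ih.1 h]
        exact max_eq_right (by linarith)
      · rw [ih.2 k hk]
        push_cast
        grind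
    | true =>
      have hc : Nat.count (fun s => f s = true) (t + 1)
          = Nat.count (fun s => f s = true) t + 1 := by
        simp [Nat.count_succ, hft]
      rw [hc]
      refine ⟨fun h => by omega, fun k hk => ?_⟩
      have hk' : Nat.count (fun s => f s = true) t = k := by omega
      have hs : frameStart f k = t := by
        rw [← hk']
        exact Nat.nth_count (p := fun s => f s = true) hft
      have hq : S.slotQueue a t = S.queue f a k := by
        cases k with
        | zero => exact ih.1 hk'
        | succ j =>
          rw [ih.2 j hk', queue, frameSize, hs]
      change max (S.slotQueue a t + S.p (a t) - S.β) 0 = _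
      rw [hs, hq]
      push_cast
      congr 1
      ring

theorem slotQueue_eq_queue (hidle : ∀ t, f t = false → a t = S.idle) {t : ℕ} (ht : f t = true) :
    S.slotQueue a t = S.queue f a (Nat.count (fun s => f s = true) t) := by
  cases hk : Nat.count (fun s => f s = true) t with
  | zero => exact (queue_count hidle t).1 hk
  | succ j =>
    have hs : frameStart f (j + 1) = t := by
      rw [← hk]
      exact Nat.nth_count (p := fun s => f s = true) ht
    rw [(queue_count hidle t).2 j hk, queue, frameSize, hs]

/-- The greedy choice for the slot queue is the greedy choice for the frame queue. -/
theorem FollowsDPP.ratio_le {V : ℝ} (h : S.FollowsDPP V f a)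
    (hidle : ∀ t, f t = false → a t = S.idle) {t : ℕ} (ht : f t = true) (x : A) :
    S.dppRatio V (S.slotQueue a t) x ≤ S.dppRatio V (S.slotQueue a t) (a t) := by
  rw [slotQueue_eq_queue hidle ht]
  exact h t ht x

theorem one_add_pos (x : A) : 0 < 1 + S.φ x / S.lam := by
  have := S.lam_pos
  have := S.φ_nonneg x
  positivity

/-- The bound is uniform over paths, which also makes the queue-weighted noise bounded. -/
theorem exists_slotQueue_le [Finite A] (S : DownloadSystem A) (V : ℝ) :
    ∃ M, ∀ (f : ℕ → Bool) (a : ℕ → A), (∀ t, f t = false → a t = S.idle) →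
      S.FollowsDPP V f a → ∀ t, S.slotQueue a t ≤ M := by
  -- The quotient is the queue level above which `x` has a negative ratio; `S.p x` covers the growth
  -- in one more slot. Actions with zero power never raise the queue, so their division by zero is
  -- harmless.
  obtain ⟨C, hC⟩ := (Set.finite_range fun x : A => V * S.B * S.φ x / S.p x + S.p x).bddAbove
  refine ⟨max C 0, fun f a hidle h t => ?_⟩
  have hβ := S.β_pos
  induction t with
  | zero => exact le_max_right _ _
  | succ t ih =>
    refine max_le ?_ (le_max_right _ _)
    rcases (S.p_nonneg (a t)).eq_or_lt with hp | hp
    · rw [← hp]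
      linarith
    · have hft : f t = true := by
        by_contra hne
        rw [hidle t (by simpa using hne), S.p_idle] at hp
        exact lt_irrefl _ hp
      have h0 := h.ratio_le hidle hft S.idle
      simp only [dppRatio, S.φ_idle, S.p_idle, mul_zero, sub_zero, zero_div] at h0
      have hnum : 0 ≤ V * S.B * S.φ (a t) - S.slotQueue a t * S.p (a t) := by
        by_contra hneg
        exact absurd h0 (not_le.2 (div_neg_of_neg_of_pos (not_le.1 hneg) (one_add_pos _)))
      have hz : S.slotQueue a t ≤ V * S.B * S.φ (a t) / S.p (a t) := by
        rw [le_div_iff₀ hp]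
        linarith
      have hle : V * S.B * S.φ (a t) / S.p (a t) + S.p (a t) ≤ C := hC ⟨a t, rfl⟩
      have := le_max_left C 0
      linarith

theorem tendsto_bounded_div {g : ℕ → ℝ} {C : ℝ} (hg : ∀ T, |g T| ≤ C) :
    Tendsto (fun T : ℕ => (1 / (T : ℝ)) * g T) atTop (nhds 0) := by
  refine tendsto_one_div_atTop_nhds_zero_nat.zero_mul_isBoundedUnder_le ?_
  exact isBoundedUnder_of ⟨C, hg⟩

theorem avgPower_le_of_slotQueue_le {M : ℝ} (hM : ∀ t, S.slotQueue a t ≤ M) :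
    S.avgPower a ≤ S.β := by
  have hM0 : 0 ≤ M := (S.slotQueue_nonneg a 0).trans (hM 0)
  have hlim : Tendsto (fun T : ℕ => S.β + (1 / (T : ℝ)) * M) atTop (nhds S.β) := by
    simpa using (tendsto_bounded_div (g := fun _ => M) fun _ => le_rfl).const_add S.β
  rw [← hlim.limsup_eq]
  refine limsup_le_limsup (Eventually.of_forall fun T => ?_) ?_ hlim.isBoundedUnder_le
  · rcases Nat.eq_zero_or_pos T with rfl | hT
    · simpa using S.β_pos.le
    have hT' : (0 : ℝ) < T := by positivity
    have h := (S.sum_p_le a T).trans (add_le_add_right (hM T) _)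
    calc (1 / (T : ℝ)) * ∑ t ∈ Finset.range T, S.p (a t) ≤ (1 / (T : ℝ)) * (S.β * T + M) := by
          gcongr
      _ = S.β + (1 / (T : ℝ)) * M := by field_simp
  · refine IsBoundedUnder.isCoboundedUnder_le (isBoundedUnder_of ⟨0, fun T => ?_⟩)
    have := Finset.sum_nonneg fun t (_ : t ∈ Finset.range T) => S.p_nonneg (a t)
    change (0 : ℝ) ≤ _
    positivity

end DownloadSystem

/-! ### Pathwise drift analysis and the linear program -/

namespace DownloadSystem

variable {A : Type*} (S : DownloadSystem A)

/-- Indicator of state 0. -/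
def idleInd (b : Bool) : ℝ := if b then 0 else 1

theorem idleInd_nonneg (b : Bool) : 0 ≤ idleInd b := by cases b <;> simp [idleInd]

theorem idleInd_le_one (b : Bool) : idleInd b ≤ 1 := by cases b <;> simp [idleInd]

/-- Deviation of the indicator of state 0 at slot `t + 1` from its conditional probability. -/
noncomputable def surprise (f : ℕ → Bool) (a : ℕ → A) (t : ℕ) : ℝ :=
  idleInd (f (t + 1)) - (if f t then S.φ (a t) else 1 - S.lam)

/-- Fractions of slots per action in state 1 that a stationary policy can achieve. -/
structure IsFeasible [Fintype A] (w : A → ℝ) : Prop where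
  nonneg : ∀ x, 0 ≤ w x
  busy : ∑ x, w x * (1 + S.φ x / S.lam) = 1
  power : ∑ x, w x * S.p x ≤ S.β

variable {S} {f : ℕ → Bool} {a : ℕ → A}

/-- A slot in state 1 counts for the mean frame size of its action. -/
theorem busy_eq (t : ℕ) :
    (if f t then 1 + S.φ (a t) / S.lam else 0)
      = 1 + (idleInd (f (t + 1)) - idleInd (f t) - S.surprise f a t) / S.lam := by
  have hlam := S.lam_pos.ne'
  cases hft : f t with
  | false =>
    simp only [surprise, hft, idleInd]
    simp
    field_simp
    ring
  | true =>
    simp only [surprise, hft, idleInd]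
    simp

theorem sum_busy_eq (T : ℕ) :
    ∑ t ∈ Finset.range T, (if f t then 1 + S.φ (a t) / S.lam else 0)
      = T + (idleInd (f T) - idleInd (f 0)) / S.lam
        - (∑ t ∈ Finset.range T, S.surprise f a t) / S.lam := by
  rw [Finset.sum_congr rfl fun t _ => busy_eq t, Finset.sum_add_distrib, ← Finset.sum_div,
    Finset.sum_sub_distrib, Finset.sum_range_sub (fun t => idleInd (f t))]
  simp
  ring

theorem tendsto_average_busy
    (hs : Tendsto (fun T : ℕ => (1 / (T : ℝ)) * ∑ t ∈ Finset.range T, S.surprise f a t) atTop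
      (nhds 0)) :
    Tendsto (fun T : ℕ => (1 / (T : ℝ)) *
      ∑ t ∈ Finset.range T, (if f t then 1 + S.φ (a t) / S.lam else 0)) atTop (nhds 1) := by
  have hb : Tendsto (fun T : ℕ => (1 / (T : ℝ)) * (idleInd (f T) - idleInd (f 0))) atTop
      (nhds 0) := by
    refine tendsto_bounded_div (C := 1) fun T => abs_le.2 ?_
    have h1 := idleInd_nonneg (f T)
    have h2 := idleInd_le_one (f T)
    have h3 := idleInd_nonneg (f 0)
    have h4 := idleInd_le_one (f 0)
    constructor <;> linarith
  have hlim := ((hb.div_const S.lam).const_add 1).sub (hs.div_const S.lam)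
  simp only [zero_div, add_zero, sub_zero] at hlim
  refine hlim.congr' ?_
  filter_upwards [eventually_gt_atTop 0] with T hT
  have hT' : (T : ℝ) ≠ 0 := by positivity
  have hlam := S.lam_pos.ne'
  rw [sum_busy_eq]
  field_simp

/-- The greedy action does at least as well as any feasible mixture. -/
theorem FollowsDPP.mixture_le [Fintype A] {V : ℝ} (h : S.FollowsDPP V f a)
    (hidle : ∀ t, f t = false → a t = S.idle) {w : A → ℝ} (hw : S.IsFeasible w) {t : ℕ}
    (ht : f t = true) :
    (1 + S.φ (a t) / S.lam) * (V * ∑ x, w x * (S.B * S.φ x) - S.slotQueue a t * S.β)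
      ≤ V * S.B * S.φ (a t) - S.slotQueue a t * S.p (a t) := by
  set Z := S.slotQueue a t
  have hZ : 0 ≤ Z := S.slotQueue_nonneg a t
  set ρ := S.dppRatio V Z (a t) with hρ
  have hρ' : ρ * (1 + S.φ (a t) / S.lam) = V * S.B * S.φ (a t) - Z * S.p (a t) :=
    div_mul_cancel₀ _ (one_add_pos _).ne'
  have hx : ∀ x, w x * (V * S.B * S.φ x - Z * S.p x) ≤ ρ * (w x * (1 + S.φ x / S.lam)) := by
    intro x
    have h1 := h.ratio_le hidle ht x
    rw [← hρ, dppRatio, div_le_iff₀ (one_add_pos x)] at h1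
    calc w x * (V * S.B * S.φ x - Z * S.p x) ≤ w x * (ρ * (1 + S.φ x / S.lam)) :=
          mul_le_mul_of_nonneg_left h1 (hw.nonneg x)
      _ = _ := by ring
  have hsum := Finset.sum_le_sum fun x (_ : x ∈ Finset.univ) => hx x
  -- The numbers `w x * (1 + S.φ x / S.lam)` are convex weights, so the maximal ratio dominates the
  -- mixture.
  rw [← Finset.mul_sum, hw.busy, mul_one] at hsum
  have hsplit : ∑ x, w x * (V * S.B * S.φ x - Z * S.p x)
      = V * ∑ x, w x * (S.B * S.φ x) - Z * ∑ x, w x * S.p x := by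
    rw [Finset.mul_sum, Finset.mul_sum, ← Finset.sum_sub_distrib]
    exact Finset.sum_congr rfl fun x _ => by ring
  rw [hsplit] at hsum
  have hpow := mul_le_mul_of_nonneg_left hw.power hZ
  rw [← hρ', mul_comm]
  exact mul_le_mul_of_nonneg_right (by linarith) (one_add_pos _).le

variable (S f a) in
/-- Quadratic Lyapunov function, corrected for the expected decrease of the queue over the rest
of an idle period. -/
noncomputable def lyapunov (t : ℕ) : ℝ :=
  S.slotQueue a t ^ 2 / 2 - S.β / S.lam * (S.slotQueue a t * idleInd (f t))

/-- In state 0 the correction cancels the drain `β * Z`. In state 1 it charges in advance the mean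
drain of the idle period that follows a completion, turning `β` into `β * (1 + φ / lam)`, which is
what the greedy comparison controls. -/
theorem FollowsDPP.lyapunov_drift [Fintype A] {V Pm : ℝ} (h : S.FollowsDPP V f a)
    (hidle : ∀ t, f t = false → a t = S.idle) {w : A → ℝ} (hw : S.IsFeasible w)
    (hPm : ∀ x, |S.p x| ≤ Pm) (t : ℕ) :
    S.lyapunov f a (t + 1) - S.lyapunov f a t
      ≤ ((Pm + S.β) ^ 2 / 2 + S.β ^ 2 / S.lam) + V * (S.B * S.φ (a t))
        - V * (∑ x, w x * (S.B * S.φ x)) * (if f t then 1 + S.φ (a t) / S.lam else 0)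
        - S.β / S.lam * (S.slotQueue a (t + 1) * S.surprise f a t) := by
  have hβ := S.β_pos
  have hlam := S.lam_pos
  have hlam1 := S.lam_le_one
  have hsq := S.sq_slotQueue_succ_le a t
  have hge := S.slotQueue_succ_ge a t
  have hp0 := S.p_nonneg (a t)
  have hp1 := (abs_le.1 (hPm (a t))).2
  have hpsq : (S.p (a t) - S.β) ^ 2 ≤ (Pm + S.β) ^ 2 := by
    apply sq_le_sq'
    · linarith
    · linarith
  have hc : 0 < S.β / S.lam := by positivity
  set Z := S.slotQueue a t with hZ
  set Z' := S.slotQueue a (t + 1)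
  set c := S.β / S.lam with hcdef
  have hcl : c * S.lam = S.β := div_mul_cancel₀ _ hlam.ne'
  have hcβ : S.β ^ 2 / S.lam = c * S.β := by rw [hcdef]; ring
  set μ := ∑ x, w x * (S.B * S.φ x)
  have hZstep : Z - S.β ≤ Z' := by linarith
  have hL' : S.lyapunov f a (t + 1) = Z' ^ 2 / 2 - c * (Z' * idleInd (f (t + 1))) := rfl
  have hL : S.lyapunov f a t = Z ^ 2 / 2 - c * (Z * idleInd (f t)) := rfl
  rw [hL', hL, surprise, hcβ]
  -- The next state contributes the same term to both sides, so its value does not matter.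
  generalize idleInd (f (t + 1)) = u
  cases hft : f t with
  | false =>
    have hφ : S.φ (a t) = 0 := by rw [hidle t hft, S.φ_idle]
    have hp : S.p (a t) = 0 := by rw [hidle t hft, S.p_idle]
    rw [hp] at hsq hpsq
    simp only [idleInd, hφ, Bool.false_eq_true, if_false]
    -- The correction is evaluated at the updated queue; replacing it by `Z - β` costs at most `β ^
    -- 2 / lam`, the second part of the constant.
    have h1 : c * (1 - S.lam) * (Z - S.β) ≤ c * (1 - S.lam) * Z' :=
      mul_le_mul_of_nonneg_left hZstep (mul_nonneg hc.le (by linarith))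
    have h2 : 0 ≤ c * S.lam * S.β := by positivity
    have h3 : c * S.lam * Z = S.β * Z := by rw [hcl]
    nlinarith
  | true =>
    have hmix := h.mixture_le hidle hw hft
    rw [← hZ] at hmix
    simp only [idleInd, if_true]
    have hφ0 := S.φ_nonneg (a t)
    have hφ1 := S.φ_le_one (a t)
    have h1 : c * S.φ (a t) * (Z - S.β) ≤ c * S.φ (a t) * Z' :=
      mul_le_mul_of_nonneg_left hZstep (mul_nonneg hc.le hφ0)
    have h2 : c * S.φ (a t) * S.β ≤ c * 1 * S.β := by gcongr
    have h3 : S.φ (a t) / S.lam * S.β = c * S.φ (a t) := by rw [hcdef]; ring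
    have h4 : (1 + S.φ (a t) / S.lam) * (V * μ - Z * S.β)
        = V * μ * (1 + S.φ (a t) / S.lam) - Z * S.β - Z * (c * S.φ (a t)) := by
      rw [← h3]; ring
    rw [h4] at hmix
    nlinarith

theorem FollowsDPP.sum_throughput_ge [Fintype A] {V Pm : ℝ} (h : S.FollowsDPP V f a)
    (hidle : ∀ t, f t = false → a t = S.idle) {w : A → ℝ} (hw : S.IsFeasible w)
    (hPm : ∀ x, |S.p x| ≤ Pm) (T : ℕ) :
    S.lyapunov f a T - S.lyapunov f a 0
        + V * (∑ x, w x * (S.B * S.φ x)) *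
          ∑ t ∈ Finset.range T, (if f t then 1 + S.φ (a t) / S.lam else 0)
        + S.β / S.lam * ∑ t ∈ Finset.range T, S.slotQueue a (t + 1) * S.surprise f a t
      ≤ T * ((Pm + S.β) ^ 2 / 2 + S.β ^ 2 / S.lam)
        + V * ∑ t ∈ Finset.range T, S.B * S.φ (a t) := by
  induction T with
  | zero => simp
  | succ T ih =>
    have hd := h.lyapunov_drift hidle hw hPm T
    simp only [Finset.sum_range_succ, mul_add]
    push_cast
    linarith

theorem abs_lyapunov_le {M : ℝ} (hM : ∀ t, S.slotQueue a t ≤ M) (t : ℕ) :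
    |S.lyapunov f a t| ≤ M ^ 2 / 2 + S.β / S.lam * M := by
  have hβ := S.β_pos
  have hlam := S.lam_pos
  have h0 := S.slotQueue_nonneg a t
  have h1 := hM t
  have h2 := idleInd_nonneg (f t)
  have h3 := idleInd_le_one (f t)
  have h4 : S.slotQueue a t ^ 2 ≤ M ^ 2 := pow_le_pow_left₀ h0 h1 2
  have h5 : S.β / S.lam * (S.slotQueue a t * idleInd (f t)) ≤ S.β / S.lam * M := by
    gcongr
    exact (mul_le_of_le_one_right h0 h3).trans h1
  have h6 : 0 ≤ S.β / S.lam * (S.slotQueue a t * idleInd (f t)) := by positivity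
  have h7 := sq_nonneg (S.slotQueue a t)
  rw [lyapunov, abs_le]
  constructor <;> linarith

/-- Performance of the algorithm on a path on which the averages of the noise vanish. -/
theorem FollowsDPP.throughput_ge [Fintype A] {V Pm M : ℝ} (hV : 0 < V) (h : S.FollowsDPP V f a)
    (hidle : ∀ t, f t = false → a t = S.idle) {w : A → ℝ} (hw : S.IsFeasible w)
    (hPm : ∀ x, |S.p x| ≤ Pm) (hM : ∀ t, S.slotQueue a t ≤ M)
    (hs : Tendsto (fun T : ℕ => (1 / (T : ℝ)) * ∑ t ∈ Finset.range T, S.surprise f a t) atTop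
      (nhds 0))
    (hqs : Tendsto (fun T : ℕ => (1 / (T : ℝ)) *
      ∑ t ∈ Finset.range T, S.slotQueue a (t + 1) * S.surprise f a t) atTop (nhds 0)) :
    ∑ x, w x * (S.B * S.φ x) - ((Pm + S.β) ^ 2 / 2 + S.β ^ 2 / S.lam) / V ≤ S.throughput a := by
  set C := (Pm + S.β) ^ 2 / 2 + S.β ^ 2 / S.lam with hC
  set μ := ∑ x, w x * (S.B * S.φ x) with hμ
  have hly : Tendsto (fun T : ℕ => (1 / (T : ℝ)) * (S.lyapunov f a T - S.lyapunov f a 0)) atTop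
      (nhds 0) :=
    tendsto_bounded_div fun T => (abs_sub _ _).trans
      (add_le_add (abs_lyapunov_le hM T) (abs_lyapunov_le hM 0))
  have hlim := (((hly.add ((tendsto_average_busy hs).const_mul (V * μ))).add
    (hqs.const_mul (S.β / S.lam))).sub_const C).div_const V
  have hval : (0 + V * μ * 1 + S.β / S.lam * 0 - C) / V = μ - C / V := by
    field_simp
    ring
  rw [hval] at hlim
  rw [← hlim.liminf_eq]
  refine liminf_le_liminf ?_ hlim.isBoundedUnder_ge
    (isBoundedUnder_le_average S.abs_B_mul_φ_le a).isCoboundedUnder_ge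
  filter_upwards [eventually_gt_atTop 0] with T hT
  have hT' : (0 : ℝ) < T := by positivity
  have hsum := mul_le_mul_of_nonneg_left (h.sum_throughput_ge hidle hw hPm T)
    (one_div_pos.2 hT').le
  rw [← hC, ← hμ] at hsum
  rw [div_le_iff₀ hV]
  have hTC : (1 / (T : ℝ)) * (T * C) = C := by field_simp
  linarith

/-- On a path with vanishing noise averages that meets the power budget, the throughput does not
exceed the value of some feasible vector. -/
theorem exists_isFeasible_throughput_le [Fintype A]
    (hidle : ∀ t, f t = false → a t = S.idle) (hpow : S.avgPower a ≤ S.β)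
    (hs : Tendsto (fun T : ℕ => (1 / (T : ℝ)) * ∑ t ∈ Finset.range T, S.surprise f a t) atTop
      (nhds 0)) :
    ∃ w, S.IsFeasible w ∧ S.throughput a ≤ ∑ x, w x * (S.B * S.φ x) := by
  classical
  -- Frequencies of the actions in state 1 only; idle actions forced by state 0 are not counted.
  set v : ℕ → A → ℝ := fun T x =>
    (1 / (T : ℝ)) * ∑ t ∈ Finset.range T, (if f t then (if a t = x then 1 else 0) else 0) with hv
  have hvsum : ∀ (g : A → ℝ) (T : ℕ), ∑ x, v T x * g x
      = (1 / (T : ℝ)) * ∑ t ∈ Finset.range T, (if f t then g (a t) else 0) := by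
    intro g T
    simp only [hv, mul_assoc, Finset.sum_mul, ← Finset.mul_sum]
    rw [Finset.sum_comm]
    congr 1
    refine Finset.sum_congr rfl fun t _ => ?_
    cases f t <;> simp
  have hvnn : ∀ T x, 0 ≤ v T x := fun T x => by
    have := Finset.sum_nonneg fun t (_ : t ∈ Finset.range T) =>
      (by split_ifs <;> norm_num :
        (0 : ℝ) ≤ (if f t then (if a t = x then 1 else 0) else 0))
    simp only [hv]
    positivity
  have hvle : ∀ T x, v T x ≤ 1 := fun T x => by
    rcases Nat.eq_zero_or_pos T with rfl | hT
    · simp [hv]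
    have hT' : (0 : ℝ) < T := by positivity
    have := Finset.sum_le_sum fun t (_ : t ∈ Finset.range T) =>
      (by split_ifs <;> norm_num :
        (if f t then (if a t = x then (1 : ℝ) else 0) else 0) ≤ 1)
    simp only [Finset.sum_const, Finset.card_range, nsmul_eq_mul, mul_one] at this
    simp only [hv]
    rw [one_div_mul_eq_div, div_le_one hT']
    exact this
  obtain ⟨w, -, ψ, hψ, hlim⟩ := (isCompact_Icc (a := (0 : A → ℝ)) (b := 1)).tendsto_subseq
    (x := v) fun T => ⟨fun x => hvnn T x, fun x => hvle T x⟩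
  have hlim' : ∀ x, Tendsto (fun k => v (ψ k) x) atTop (nhds (w x)) := tendsto_pi_nhds.1 hlim
  have hsumlim : ∀ g : A → ℝ, Tendsto (fun k => ∑ x, v (ψ k) x * g x) atTop
      (nhds (∑ x, w x * g x)) := fun g =>
    tendsto_finsetSum _ fun x _ => (hlim' x).mul_const _
  -- Power and success probability vanish at the idle action, so for them the restriction to state 1
  -- is immaterial.
  have hidle0 : ∀ g : A → ℝ, g S.idle = 0 → ∀ t, (if f t then g (a t) else 0) = g (a t) := by
    intro g hg t
    cases hft : f t with
    | false => simp [hidle t hft, hg]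
    | true => simp
  refine ⟨w, ⟨fun x => ge_of_tendsto' (hlim' x) fun k => hvnn _ _, ?_, ?_⟩, ?_⟩
  · refine tendsto_nhds_unique (hsumlim fun x => 1 + S.φ x / S.lam) ?_
    simp_rw [hvsum]
    exact (tendsto_average_busy hs).comp hψ.tendsto_atTop
  · obtain ⟨C, hC⟩ := S.exists_abs_p_le
    refine le_of_forall_pos_le_add fun ε hε => le_of_tendsto (hsumlim S.p) ?_
    have hev := eventually_lt_of_limsup_lt (lt_of_le_of_lt hpow (lt_add_of_pos_right S.β hε))
      (isBoundedUnder_le_average hC a)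
    filter_upwards [hψ.tendsto_atTop.eventually hev] with k hk
    rw [hvsum]
    simp_rw [hidle0 S.p S.p_idle]
    exact hk.le
  · refine le_of_forall_pos_le_add fun ε hε => ?_
    rw [← sub_le_iff_le_add]
    refine ge_of_tendsto (hsumlim fun x => S.B * S.φ x) ?_
    have hev := eventually_lt_of_lt_liminf (sub_lt_self (S.throughput a) hε)
      (isBoundedUnder_ge_average S.abs_B_mul_φ_le a)
    filter_upwards [hψ.tendsto_atTop.eventually hev] with k hk
    rw [hvsum]
    simp_rw [hidle0 (fun x => S.B * S.φ x) (by simp [S.φ_idle])]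
    exact hk.le

end DownloadSystem

/-! ### Almost sure vanishing of the noise averages -/

namespace DownloadSystem

variable {A : Type*} [Finite A] {S : DownloadSystem A} {Ω : Type*} [m : MeasurableSpace Ω]
  {P : Measure Ω} [IsProbabilityMeasure P] {ℱ : Filtration ℕ m} {F : ℕ → Ω → Bool}
  {α : ℕ → Ω → A}

omit [IsProbabilityMeasure P] in
theorem IsControlled.measurable_action (h : S.IsControlled P ℱ F α) (t : ℕ) (g : A → ℝ) :
    Measurable[ℱ t] (fun ω => g (α t ω)) := by
  let _ : MeasurableSpace A := ⊤
  have hα : Measurable[ℱ t] (α t) :=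
    @measurable_to_countable' _ _ _ _ (ℱ t) _ (fun x => h.action_adapted t x)
  exact measurable_from_top.comp hα

omit [IsProbabilityMeasure P] [Finite A] in
theorem IsControlled.measurable_ite (h : S.IsControlled P ℱ F α) {t s : ℕ} {u v : Ω → ℝ}
    (hts : t ≤ s) (hu : Measurable[ℱ s] u) (hv : Measurable[ℱ s] v) :
    Measurable[ℱ s] (fun ω => if F t ω then u ω else v ω) :=
  Measurable.ite (ℱ.mono hts _ (h.state_adapted t)) hu hv

omit [IsProbabilityMeasure P] in
theorem IsControlled.measurable_surprise (h : S.IsControlled P ℱ F α) (t : ℕ) :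
    Measurable[ℱ (t + 1)] (fun ω => S.surprise (fun s => F s ω) (fun s => α s ω) t) :=
  (h.measurable_ite le_rfl measurable_const measurable_const).sub
    (h.measurable_ite t.le_succ
      ((h.measurable_action t S.φ).mono (ℱ.mono t.le_succ) le_rfl) measurable_const)

omit [IsProbabilityMeasure P] in
-- The queue at `t + 1` depends only on actions up to `t`. This predictability keeps its product
-- with the surprise at `t` a martingale difference.
theorem IsControlled.measurable_slotQueue (h : S.IsControlled P ℱ F α) (t : ℕ) :
    Measurable[ℱ t] (fun ω => S.slotQueue (fun s => α s ω) (t + 1)) := by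
  induction t with
  | zero =>
    exact ((measurable_const.add (h.measurable_action 0 S.p)).sub_const _).max measurable_const
  | succ t ih =>
    exact (((ih.mono (ℱ.mono t.le_succ) le_rfl).add
      (h.measurable_action (t + 1) S.p)).sub_const _).max measurable_const

omit [Finite A] in
theorem abs_surprise_le (S : DownloadSystem A) (f : ℕ → Bool) (a : ℕ → A) (t : ℕ) :
    |S.surprise f a t| ≤ 1 := by
  have h1 := idleInd_nonneg (f (t + 1))
  have h2 := idleInd_le_one (f (t + 1))
  have h3 := S.φ_nonneg (a t)
  have h4 := S.φ_le_one (a t)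
  have h5 := S.lam_pos
  have h6 := S.lam_le_one
  rw [surprise, abs_le]
  split_ifs <;> constructor <;> linarith

theorem IsControlled.condExp_surprise (h : S.IsControlled P ℱ F α) (t : ℕ) :
    P[fun ω => S.surprise (fun s => F s ω) (fun s => α s ω) t | ℱ t] =ᵐ[P] 0 := by
  set g : Ω → ℝ := fun ω => if F t ω then S.φ (α t ω) else 1 - S.lam with hg
  set X : Ω → ℝ := {ω | F (t + 1) ω = false}.indicator fun _ => (1 : ℝ) with hX
  set X' : Ω → ℝ := {ω | F (t + 1) ω = true}.indicator fun _ => (1 : ℝ) with hX'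
  have hgm : Measurable[ℱ t] g :=
    h.measurable_ite le_rfl (h.measurable_action t S.φ) measurable_const
  have hmt : MeasurableSet {ω | F (t + 1) ω = true} :=
    ℱ.le _ _ (h.state_adapted (t + 1))
  have hmf : MeasurableSet {ω | F (t + 1) ω = false} := by
    convert hmt.compl using 1
    ext ω
    simp
  have hXi : Integrable X P := (integrable_const 1).indicator hmf
  have hXi' : Integrable X' P := (integrable_const 1).indicator hmt
  have hgi : Integrable g P := by
    refine integrable_of_abs_le (K := 1) (hgm.mono (ℱ.le t) le_rfl) fun ω => ?_
    have h3 := S.φ_nonneg (α t ω)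
    have h4 := S.φ_le_one (α t ω)
    have h5 := S.lam_pos
    have h6 := S.lam_le_one
    rw [abs_le]
    simp only [hg]
    split_ifs <;> constructor <;> linarith
  have hXX' : X = (fun _ => (1 : ℝ)) - X' := by
    ext ω
    cases hF : F (t + 1) ω <;> simp [hX, hX', hF]
  have hfun : (fun ω => S.surprise (fun s => F s ω) (fun s => α s ω) t) = X - g := by
    ext ω
    cases hF : F (t + 1) ω <;> simp [surprise, idleInd, hX, hg, hF]
  rw [hfun]
  have hcX' : P[X | ℱ t] =ᵐ[P] P[fun _ => (1 : ℝ) | ℱ t] - P[X' | ℱ t] := by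
    rw [hXX']
    exact condExp_sub (integrable_const _) hXi' _
  have hcg : P[g | ℱ t] = g := condExp_of_stronglyMeasurable (ℱ.le t) hgm.stronglyMeasurable hgi
  filter_upwards [condExp_sub hXi hgi (ℱ t), hcX', h.trans_active t, h.trans_inactive t]
    with ω h1 h2 h3 h4
  rw [condExp_const (ℱ.le t)] at h2
  rw [h1, Pi.sub_apply, hcg]
  simp only [Pi.zero_apply, hg]
  cases hF : F t ω with
  | true =>
    rw [h3 hF]
    simp
  | false =>
    rw [h2, Pi.sub_apply, h4 hF]
    simp

theorem IsControlled.ae_tendsto_average_surprise (h : S.IsControlled P ℱ F α) :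
    ∀ᵐ ω ∂P, Tendsto (fun T : ℕ => (1 / (T : ℝ)) * ∑ t ∈ Finset.range T,
      S.surprise (fun s => F s ω) (fun s => α s ω) t) atTop (nhds 0) :=
  ae_tendsto_average_of_condExp_eq_zero h.measurable_surprise
    (fun _ _ => S.abs_surprise_le _ _ _) h.condExp_surprise

theorem IsControlled.ae_tendsto_average_slotQueue_mul_surprise (h : S.IsControlled P ℱ F α)
    {M : ℝ} (hM : ∀ ω t, S.slotQueue (fun s => α s ω) t ≤ M) :
    ∀ᵐ ω ∂P, Tendsto (fun T : ℕ => (1 / (T : ℝ)) * ∑ t ∈ Finset.range T,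
      S.slotQueue (fun s => α s ω) (t + 1) * S.surprise (fun s => F s ω) (fun s => α s ω) t)
      atTop (nhds 0) := by
  have habs : ∀ t ω, |S.slotQueue (fun s => α s ω) t| ≤ M := fun t ω => by
    rw [abs_of_nonneg (S.slotQueue_nonneg _ _)]
    exact hM ω t
  refine ae_tendsto_average_of_condExp_eq_zero (ℱ := ℱ) (K := M * 1) (fun t => ?_)
    (fun t ω => ?_) fun t => ?_
  · exact ((h.measurable_slotQueue t).mono (ℱ.mono t.le_succ) le_rfl).mul
      (h.measurable_surprise t)
  · rw [abs_mul]
    exact mul_le_mul (habs _ ω) (S.abs_surprise_le _ _ _) (abs_nonneg _)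
      ((abs_nonneg _).trans (habs 0 ω))
  · have hint := integrable_of_abs_le (P := P)
      ((h.measurable_surprise t).mono (ℱ.le _) le_rfl) fun ω => S.abs_surprise_le _ _ _
    filter_upwards [condExp_stronglyMeasurable_mul_of_bound (ℱ.le t)
      (h.measurable_slotQueue t).stronglyMeasurable hint M (ae_of_all P fun ω => habs (t + 1) ω),
      h.condExp_surprise t] with ω h1 h2
    refine h1.trans ?_
    rw [Pi.mul_apply, h2]
    simp

/-- Any bound on the values of the feasible vectors bounds the optimal throughput. -/
theorem optThroughput_le [Fintype A] {c : ℝ} (hc : 0 ≤ c)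
    (hw : ∀ w, S.IsFeasible w → ∑ x, w x * (S.B * S.φ x) ≤ c) : S.optThroughput ≤ c := by
  refine Real.sSup_le ?_ hc
  rintro r ⟨Ω', m', P', ℱ', F', α', hP', hctrl, hpow, rfl⟩
  have hle : ∀ᵐ ω ∂P', S.throughput (fun t => α' t ω) ≤ c := by
    filter_upwards [hpow, hctrl.ae_tendsto_average_surprise] with ω h1 h2
    obtain ⟨w, hfeas, hthr⟩ := exists_isFeasible_throughput_le
      (fun t => hctrl.idle_of_inactive t ω) h1 h2
    exact hthr.trans (hw w hfeas)
  calc ∫ ω, S.throughput (fun t => α' t ω) ∂P' ≤ ∫ _, c ∂P' :=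
        integral_mono_of_nonneg (ae_of_all _ fun ω => S.throughput_nonneg _)
          (integrable_const _) hle
    _ = c := by simp

end DownloadSystem

/-! ### The main theorem -/

open DownloadSystem in
theorem theorem1 {A : Type*} [Finite A] (S : DownloadSystem A) :
    ∃ C₀ : ℝ, ∀ V : ℝ, 0 ≤ V →
      ∀ (Ω : Type*) [m : MeasurableSpace Ω] (P : Measure Ω) [IsProbabilityMeasure P]
        (ℱ : Filtration ℕ m) (F : ℕ → Ω → Bool) (α : ℕ → Ω → A),
        S.IsControlled P ℱ F α →
        (∀ ω, S.FollowsDPP V (fun t => F t ω) (fun t => α t ω)) →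
        (∀ ω, S.avgPower (fun t => α t ω) ≤ S.β) ∧
        (0 < V → ∀ᵐ ω ∂P, S.optThroughput - C₀ / V ≤ S.throughput (fun t => α t ω)) := by
  have := Fintype.ofFinite A
  obtain ⟨Pm, hPm⟩ := S.exists_abs_p_le
  refine ⟨(Pm + S.β) ^ 2 / 2 + S.β ^ 2 / S.lam,
    fun V _ Ω m P _ ℱ F α hctrl hdpp => ?_⟩
  obtain ⟨M, hM⟩ := S.exists_slotQueue_le V
  have hidle : ∀ ω t, F t ω = false → α t ω = S.idle := fun ω t => hctrl.idle_of_inactive t ω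
  have hMω : ∀ ω t, S.slotQueue (fun s => α s ω) t ≤ M := fun ω =>
    hM (fun t => F t ω) _ (hidle ω) (hdpp ω)
  refine ⟨fun ω => avgPower_le_of_slotQueue_le (hMω ω), fun hV => ?_⟩
  filter_upwards [hctrl.ae_tendsto_average_surprise,
    hctrl.ae_tendsto_average_slotQueue_mul_surprise hMω] with ω h1 h2
  have hβ := S.β_pos
  have hlam := S.lam_pos
  rw [sub_le_iff_le_add]
  -- No optimal vector is needed: on this path the throughput plus the loss bounds the value of
  -- every feasible vector at once.
  refine optThroughput_le ?_ fun w hw => ?_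
  · have := S.throughput_nonneg (fun t => α t ω)
    positivity
  · rw [← sub_le_iff_le_add]
    exact (hdpp ω).throughput_ge hV (hidle ω) hw hPm (hMω ω) h1 h2
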